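/- Let $k$ be a field that is complete with respect to a nontrivial non-Archimedean absolute value, let $\mathfrak{o}_k=\{a\in k:|a|\le 1\}$ be its valuation ring, and let $$F=\sum_{i_1,\dots,i_l\ge 0} c_{i_1\cdots i_l}\,x_1^{i_1}\cdots x_l^{i_l}\in k\langle x_1,\dots,x_l\rangle$$ be a restricted power series, i.e. a formal power series with $c_{i_1\cdots i_l}\to 0$ as $i_1+\dots+i_l\to\infty$ (so that the series converges on $\mathfrak{o}_k^l$). For $n\in\{1,\dots,l\}$ and $a=(a_1,\dots,a_l)\in\mathfrak{o}_k^l$ let $$F_{n,a}=\sum_{j=0}^{\infty}\Big(\sum_{\substack{i_1,\dots,i_l\ge 0\\ i_n=j}} c_{i_1\cdots i_l}\prod_{m\ne n}a_m^{i_m}\Big)x_n^{j}\in k[[x_n]]$$ be the power series obtained from $F$ by substituting $a_m$ for $x_m$ for all $m\neq n$. Suppose that $F_{n,a}\in k(x_n)$ for every $n\in\{1,\dots,l\}$ and every $a\in\mathfrak{o}_k^l$, i.e. that $F_{n,a}$ is a quotient of two polynomials in $k[x_n]$ with nonzero denominator. Then $F\in k(x_1,\dots,x_l)$, i.e. $F$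 is, in the fraction field of $k[[x_1,\dots,x_l]]$, a quotient of two polynomials in $k[x_1,\dots,x_l]$ with nonzero denominator. -/

import Mathlib

/-- A power series `F` in `x₁, …, x_l` over a field `k` lies in `k(x₁, …, x_l)`: in the fraction
field of `k⟦x₁, …, x_l⟧` it is the quotient of two polynomials. -/
def MvPowerSeries.IsRationalFunction {k : Type*} [Field k] {l : ℕ}
    (F : MvPowerSeries (Fin l) k) : Prop :=
  ∃ p q : MvPolynomial (Fin l) k, q ≠ 0 ∧
    algebraMap (MvPowerSeries (Fin l) k) (FractionRing (MvPowerSeries (Fin l) k)) F =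
      algebraMap _ (FractionRing (MvPowerSeries (Fin l) k)) (p : MvPowerSeries (Fin l) k) /
        algebraMap _ (FractionRing (MvPowerSeries (Fin l) k)) (q : MvPowerSeries (Fin l) k)

/-- A power series `f` in one variable `x` over a field `k` lies in `k(x)`: in the fraction
field of `k⟦x⟧` it is the quotient of two polynomials. -/
def PowerSeries.IsRationalFunction {k : Type*} [Field k] (f : PowerSeries k) : Prop :=
  ∃ p q : Polynomial k, q ≠ 0 ∧
    algebraMap (PowerSeries k) (FractionRing (PowerSeries k)) f =
      algebraMap _ (FractionRing (PowerSeries k)) (p : PowerSeries k) /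
        algebraMap _ (FractionRing (PowerSeries k)) (q : PowerSeries k)

/-- The power series in the single variable `x_n` obtained from `F = ∑ c_d x^d` by substituting
`a_m` for `x_m` for every `m ≠ n`: its `j`-th coefficient is the sum of
`c_d * ∏_{m ≠ n} a_m ^ d_m` over all multi-indices `d` with `d_n = j`. The value `a_n` plays
no role. -/
noncomputable def MvPowerSeries.specializeExcept {k : Type*} [NormedField k] {l : ℕ}
    (F : MvPowerSeries (Fin l) k) (n : Fin l) (a : Fin l → k) : PowerSeries k :=
  PowerSeries.mk fun j =>
    ∑' d : {d : Fin l →₀ ℕ // d n = j},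
      MvPowerSeries.coeff d.1 F * ∏ m ∈ Finset.univ.erase n, a m ^ d.1 m

/-- The sums defining the coefficients of `specializeExcept` converge when `F` is a restricted power
series over a complete non-Archimedean field and `a` has coordinates in the valuation ring. -/
theorem MvPowerSeries.summable_specializeExcept {k : Type*} [NormedField k] [IsUltrametricDist k]
    [CompleteSpace k] {l : ℕ} (F : MvPowerSeries (Fin l) k)
    (hF : MvPowerSeries.IsRestricted (fun _ => 1) F) (n : Fin l) (a : Fin l → k)
    (ha : ∀ m, ‖a m‖ ≤ 1) (j : ℕ) :
    Summable fun d : {d : Fin l →₀ ℕ // d n = j} =>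
      MvPowerSeries.coeff d.1 F * ∏ m ∈ Finset.univ.erase n, a m ^ d.1 m := by
  apply NonarchimedeanAddGroup.summable_of_tendsto_cofinite_zero
  have h0 : Filter.Tendsto (fun d : Fin l →₀ ℕ => ‖MvPowerSeries.coeff d F‖) Filter.cofinite
      (nhds 0) := by
    simpa [MvPowerSeries.IsRestricted] using hF
  have h1 := h0.comp (Subtype.val_injective (p := fun d : Fin l →₀ ℕ => d n = j)).tendsto_cofinite
  refine squeeze_zero_norm (fun d => ?_) h1
  rw [norm_mul, norm_prod]
  refine mul_le_of_le_one_right (norm_nonneg _) (Finset.prod_le_one (fun _ _ => norm_nonneg _) ?_)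
  intro m _
  rw [norm_pow]
  exact pow_le_one₀ (norm_nonneg _) (ha m)

/-!
On the closed unit polydisc `F` converges to a function `f` which is rational in each variable
separately. By induction on the number of variables, every slice `f (x₀, ·)` is a quotient `p / q`
of polynomials. The closed unit disc is uncountable while there are only countably many finite sets
of exponents, so for infinitely many `x₀` the exponents of `p` and `q` lie in one finite set `s`.
Write `f (·, a) = u_a / w_a`. For each of these `x₀`, the coefficients of `p` and `q` form a
nontrivial linear relation between the functions `a ↦ w_a(x₀) a ^ e` and `a ↦ u_a(x₀) a ^ e`,
`e ∈ s`. A minor of the matrix with entries `w_a a ^ e` and `u_a a ^ e` in `k[x₀]` has finitely many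
zeros unless it vanishes, so dependence at infinitely many `x₀` forces dependence over `k[x₀]`, and
this relation exhibits `f` as a quotient of polynomials. The identity theorem for power series
turns the equality of functions `f * q = p` into one of power series.
-/

open Polynomial

theorem exists_det_ne_zero_of_linearIndependent_of_field {K ι ρ : Type*} [Field K] [Fintype ι]
    [DecidableEq ι] {v : ι → ρ → K} (hv : LinearIndependent K v) :
    ∃ g : ι → ρ, (Matrix.of fun i j => v i (g j)).det ≠ 0 := by
  obtain ⟨κ, r, -, hspan, hli⟩ := exists_linearIndependent' K (flip v)
  rw [span_flip_eq_top_iff_linearIndependent.mpr hv] at hspan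
  let e : ι ≃ κ := (Pi.basisFun K ι).indexEquiv (Module.Basis.mk hli hspan.ge)
  refine ⟨r ∘ e, ?_⟩
  rw [← Matrix.det_transpose, ← isUnit_iff_ne_zero, ← Matrix.isUnit_iff_isUnit_det,
    ← Matrix.linearIndependent_rows_iff_isUnit]
  exact hli.comp e e.injective

theorem exists_det_ne_zero_of_linearIndependent {A ι ρ : Type*} [CommRing A] [IsDomain A]
    [Fintype ι] [DecidableEq ι] {v : ι → ρ → A} (hv : LinearIndependent A v) :
    ∃ g : ι → ρ, (Matrix.of fun i j => v i (g j)).det ≠ 0 := by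
  let toFrac : (ρ → A) →ₗ[A] ρ → FractionRing A :=
    (Algebra.linearMap A (FractionRing A)).compLeft ρ
  have htoFrac : Function.Injective toFrac :=
    (FaithfulSMul.algebraMap_injective A (FractionRing A)).comp_left
  obtain ⟨g, hg⟩ := exists_det_ne_zero_of_linearIndependent_of_field
    ((LinearIndependent.iff_fractionRing A (FractionRing A)).mp (hv.map_injOn toFrac htoFrac.injOn))
  refine ⟨g, fun h => hg ?_⟩
  rw [← map_zero (algebraMap A (FractionRing A)), ← h, RingHom.map_det]
  rfl

theorem finite_setOf_not_linearIndependent_eval {R ι ρ : Type*} [CommRing R] [IsDomain R]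
    [Finite ι] {v : ι → ρ → R[X]} (hv : LinearIndependent R[X] v) :
    {x | ¬ LinearIndependent R fun i r => (v i r).eval x}.Finite := by
  classical
  have := Fintype.ofFinite ι
  obtain ⟨g, hg⟩ := exists_det_ne_zero_of_linearIndependent hv
  refine (Polynomial.finite_setOfPred_isRoot hg).subset fun x hx => ?_
  by_contra hroot
  apply hx
  have hdet : (Matrix.of fun i j => (v i (g j)).eval x).det ≠ 0 := by
    rwa [Set.mem_ofPred_eq, IsRoot.def, ← coe_evalRingHom, RingHom.map_det] at hroot
  exact .of_comp (LinearMap.funLeft R R g) (Matrix.linearIndependent_rows_of_det_ne_zero hdet)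

theorem eval_eq_sum_of_support_subset {R σ : Type*} [CommSemiring R] [Fintype σ]
    {p : MvPolynomial σ R} {s : Finset (σ →₀ ℕ)} (hp : p.support ⊆ s) (a : σ → R) :
    p.eval a = ∑ e : s, p.coeff e * ∏ m, a m ^ e.1 m := by
  rw [MvPolynomial.eval_eq', Finset.sum_subset hp fun e _ he => by
    rw [MvPolynomial.notMem_support_iff.mp he, zero_mul]]
  exact (Finset.sum_coe_sort s fun e => p.coeff e * ∏ m, a m ^ e m).symm

theorem exists_polynomial_relation_of_infinite {R κ σ ρ : Type*} [CommRing R] [IsDomain R]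
    [Fintype κ] [Finite σ] (c : κ → ρ → R[X]) (y : ρ → σ → R) (s : Finset (σ →₀ ℕ))
    {T : Set R} (hT : T.Infinite)
    (h : ∀ x ∈ T, ∃ p : κ → MvPolynomial σ R, p ≠ 0 ∧ (∀ i, (p i).support ⊆ s) ∧
      ∀ r, ∑ i, (c i r).eval x * (p i).eval (y r) = 0) :
    ∃ P : κ → MvPolynomial σ R[X], P ≠ 0 ∧
      ∀ r, ∑ i, c i r * (P i).eval (fun m => C (y r m)) = 0 := by
  have := Fintype.ofFinite σ
  let v : κ × s → ρ → R[X] := fun ie r => c ie.1 r * C (∏ m, y r m ^ ie.2.1 m)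
  have hv : ¬ LinearIndependent R[X] v := by
    refine fun hli => hT ((finite_setOf_not_linearIndependent_eval hli).subset fun x hx => ?_)
    obtain ⟨p, hp0, hps, hp⟩ := h x hx
    obtain ⟨i, hi⟩ := Function.ne_iff.mp hp0
    obtain ⟨e, he⟩ := MvPolynomial.ne_zero_iff.mp hi
    refine Fintype.not_linearIndependent_iff.mpr ⟨fun ie => (p ie.1).coeff ie.2, ?_,
      (i, ⟨e, hps i (MvPolynomial.mem_support_iff.mpr he)⟩), he⟩
    ext r
    simpa [v, Fintype.sum_prod_type, eval_eq_sum_of_support_subset (hps _), Finset.mul_sum,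
      eval_prod, mul_left_comm] using hp r
  obtain ⟨g, hg, ⟨i, e⟩, hne⟩ := Fintype.not_linearIndependent_iff.mp hv
  refine ⟨fun i => ∑ e : s, MvPolynomial.monomial e.1 (g (i, e)), fun hP => hne ?_, fun r => ?_⟩
  · classical
    simpa [MvPolynomial.coeff_sum, MvPolynomial.coeff_monomial] using
      congrArg (MvPolynomial.coeff e.1) (congrFun hP i)
  · simpa [v, Fintype.sum_prod_type, MvPolynomial.eval_monomial, Finsupp.prod_pow, Finset.mul_sum,
      mul_left_comm] using congrFun hg r

/-- The isomorphism `R[x₀, …, x_l] ≃ R[x₀][x₁, …, x_l]`, which makes the first variable a scalar.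
`MvPolynomial.finSuccEquiv` is the other decomposition, `R[x₁, …, x_l][x₀]`. -/
noncomputable def finSuccPolynomialEquiv (R : Type*) [CommSemiring R] (l : ℕ) :
    MvPolynomial (Fin (l + 1)) R ≃ₐ[R] MvPolynomial (Fin l) R[X] :=
  (MvPolynomial.renameEquiv R (finSuccEquiv l)).trans (MvPolynomial.optionEquivRight R _)

theorem eval_eval_finSuccPolynomialEquiv {R : Type*} [CommSemiring R] {l : ℕ}
    (p : MvPolynomial (Fin (l + 1)) R) (x : R) (a : Fin l → R) :
    ((finSuccPolynomialEquiv R l p).eval fun m => C (a m)).eval x = p.eval (Fin.cons x a) := by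
  induction p using MvPolynomial.induction_on with
  | C r => simp [finSuccPolynomialEquiv]
  | add p q hp hq => simp only [map_add, eval_add, hp, hq]
  | mul_X p i hp =>
    simp only [map_mul, eval_mul, hp]
    cases i using Fin.cases <;> simp [finSuccPolynomialEquiv]

section SeparatelyRational

variable {k : Type*} [Field k] {l : ℕ}

/-- `f` is given by a rational function on the box `S ^ l`: it satisfies `f = p / q` there, in the
form `f * q = p`, so that nothing is said about `f` at the zeros of `q`. -/
def IsRationalOn (f : (Fin l → k) → k) (S : Set k) : Prop :=
  ∃ p q : MvPolynomial (Fin l) k, q ≠ 0 ∧ ∀ a, (∀ m, a m ∈ S) → f a * q.eval a = p.eval a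

/-- `f` is a rational function of each variable on the box `S ^ l`, the other variables being fixed
in `S`. Unlike in `IsRationalOn`, the denominators `w` have no zeros in `S`. -/
def IsSeparatelyRationalOn (f : (Fin l → k) → k) (S : Set k) : Prop :=
  ∀ (n : Fin l) (a : Fin l → k), (∀ m, a m ∈ S) → ∃ u w : k[X], ∀ x ∈ S,
    w.eval x ≠ 0 ∧ f (Function.update a n x) * w.eval x = u.eval x

variable {S : Set k}

theorem IsSeparatelyRationalOn.comp_cons {f : (Fin (l + 1) → k) → k}
    (hf : IsSeparatelyRationalOn f S) {x : k} (hx : x ∈ S) :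
    IsSeparatelyRationalOn (fun a => f (Fin.cons x a)) S := by
  intro n a ha
  obtain ⟨u, w, huw⟩ := hf n.succ (Fin.cons x a) (Fin.cases hx ha)
  exact ⟨u, w, fun t ht => by simpa only [Fin.cons_update] using huw t ht⟩

theorem exists_finset_infinite_of_not_countable {f : (Fin (l + 1) → k) → k} (hS : ¬ S.Countable)
    (h : ∀ x ∈ S, IsRationalOn (fun a => f (Fin.cons x a)) S) :
    ∃ s : Finset (Fin l →₀ ℕ), {x ∈ S | ∃ p q : MvPolynomial (Fin l) k, q ≠ 0 ∧ p.support ⊆ s ∧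
      q.support ⊆ s ∧ ∀ a, (∀ m, a m ∈ S) →
        f (Fin.cons x a) * q.eval a = p.eval a}.Infinite := by
  classical
  by_contra! hfin
  refine hS ((Set.countable_iUnion fun s => (hfin s).countable).mono fun x hx => ?_)
  obtain ⟨p, q, hq, hpq⟩ := h x hx
  exact Set.mem_iUnion.mpr ⟨p.support ∪ q.support, hx, p, q, hq, Finset.subset_union_left,
    Finset.subset_union_right, hpq⟩

theorem exists_mul_eval_eq_mul_eval_of_forall_cons {f : (Fin (l + 1) → k) → k}
    (hS : ¬ S.Countable) (hcons : ∀ x ∈ S, IsRationalOn (fun a => f (Fin.cons x a)) S)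
    {u w : {a : Fin l → k // ∀ m, a m ∈ S} → k[X]} (hw : ∀ a, w a ≠ 0)
    (huw : ∀ a, ∀ x ∈ S, f (Fin.cons x a.1) * (w a).eval x = (u a).eval x) :
    ∃ P Q : MvPolynomial (Fin l) k[X], Q ≠ 0 ∧ ∀ a,
      w a * P.eval (fun m => C (a.1 m)) = u a * Q.eval (fun m => C (a.1 m)) := by
  obtain ⟨s, hs⟩ := exists_finset_infinite_of_not_countable hS hcons
  obtain ⟨P, hP0, hP⟩ : ∃ P : Fin 2 → MvPolynomial (Fin l) k[X], P ≠ 0 ∧ ∀ a,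
      ∑ i, ![w, -u] i a * (P i).eval (fun m => C (a.1 m)) = 0 := by
    refine exists_polynomial_relation_of_infinite _ _ s hs fun x hx => ?_
    obtain ⟨hxS, p, q, hq, hps, hqs, hpq⟩ := hx
    refine ⟨![p, q], fun h => hq (congrFun h 1), Fin.forall_fin_two.mpr ⟨hps, hqs⟩, fun a => ?_⟩
    simp only [Fin.sum_univ_two, Matrix.cons_val_zero, Matrix.cons_val_one, Pi.neg_apply, eval_neg,
      ← hpq a.1 a.2, ← huw a x hxS]
    ring
  have hPQ (a : {a : Fin l → k // ∀ m, a m ∈ S}) :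
      w a * (P 0).eval (fun m => C (a.1 m)) = u a * (P 1).eval (fun m => C (a.1 m)) := by
    simpa [Fin.sum_univ_two, add_neg_eq_zero] using hP a
  refine ⟨P 0, P 1, fun hQ => hP0 (funext (Fin.forall_fin_two.mpr ⟨?_, hQ⟩)), hPQ⟩
  have hinf : S.Infinite := fun h => hS h.countable
  refine MvPolynomial.funext_set (fun _ => C '' S) (fun _ => hinf.image C_injective.injOn)
    fun c hc => ?_
  choose a haS hac using fun m => hc m (Set.mem_univ m)
  obtain rfl : (fun m => C (a m)) = c := funext hac
  simpa [hQ, hw] using hPQ ⟨a, haS⟩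

theorem isRationalOn_of_forall_cons (hS : ¬ S.Countable) {f : (Fin (l + 1) → k) → k}
    (hf : IsSeparatelyRationalOn f S)
    (hcons : ∀ x ∈ S, IsRationalOn (fun a => f (Fin.cons x a)) S) : IsRationalOn f S := by
  obtain ⟨x₀, hx₀⟩ : S.Nonempty := by
    contrapose! hS
    exact hS ▸ Set.countable_empty
  have hfirst (a : {a : Fin l → k // ∀ m, a m ∈ S}) : ∃ u w : k[X], ∀ x ∈ S,
      w.eval x ≠ 0 ∧ f (Fin.cons x a) * w.eval x = u.eval x := by
    simpa only [Fin.update_cons_zero] using hf 0 (Fin.cons x₀ a.1) (Fin.cases hx₀ a.2)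
  choose u w huw using hfirst
  obtain ⟨P, Q, hQ, hPQ⟩ := exists_mul_eval_eq_mul_eval_of_forall_cons hS hcons
    (fun a h => (huw a x₀ hx₀).1 (by rw [h, eval_zero])) (fun a x hx => (huw a x hx).2)
  let e := finSuccPolynomialEquiv k l
  refine ⟨e.symm P, e.symm Q, by simpa using hQ, fun a ha => ?_⟩
  rw [← Fin.cons_self_tail a] at ha ⊢
  obtain ⟨hw, hu⟩ := huw ⟨Fin.tail a, fun m => ha m.succ⟩ (a 0) (ha 0)
  have hPQa := congrArg (eval (a 0)) (hPQ ⟨Fin.tail a, fun m => ha m.succ⟩)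
  simp only [eval_mul, ← hu] at hPQa
  rw [← eval_eval_finSuccPolynomialEquiv, ← eval_eval_finSuccPolynomialEquiv,
    AlgEquiv.apply_symm_apply, AlgEquiv.apply_symm_apply]
  apply mul_left_cancel₀ hw
  rw [hPQa]
  ring

theorem IsSeparatelyRationalOn.isRationalOn (hS : ¬ S.Countable) {f : (Fin l → k) → k}
    (hf : IsSeparatelyRationalOn f S) : IsRationalOn f S := by
  induction l with
  | zero =>
    exact ⟨MvPolynomial.C (f 0), 1, one_ne_zero, fun a _ => by simp [Subsingleton.elim a 0]⟩
  | succ l ih => exact isRationalOn_of_forall_cons hS hf fun x hx => ih (hf.comp_cons hx)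

end SeparatelyRational

section HasSum

variable {R : Type*} [CommRing R] [TopologicalSpace R] [IsTopologicalRing R]

theorem hasSum_powerSeries_mul_coe {f : PowerSeries R} {x s : R}
    (hf : HasSum (fun n => PowerSeries.coeff n f * x ^ n) s) (q : R[X]) :
    HasSum (fun n => PowerSeries.coeff n (f * (q : PowerSeries R)) * x ^ n) (s * q.eval x) := by
  induction q using Polynomial.induction_on with
  | C r => simpa [mul_right_comm] using hf.mul_right r
  | add p q hp hq => simpa [mul_add, add_mul] using hp.add hq
  | monomial n r h =>
    rw [← hasSum_nat_add_iff' 1]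
    simpa [pow_succ, ← mul_assoc, PowerSeries.coeff_succ_mul_X] using h.mul_right x

theorem hasSum_powerSeries_coe (x : R) (q : R[X]) :
    HasSum (fun n => PowerSeries.coeff n (q : PowerSeries R) * x ^ n) (q.eval x) := by
  have hone : HasSum (fun n => PowerSeries.coeff n (1 : PowerSeries R) * x ^ n) 1 := by
    convert hasSum_single 0 fun n hn => ?_ using 1 <;> simp [PowerSeries.coeff_one, *]
  simpa using hasSum_powerSeries_mul_coe hone q

variable {σ : Type*} [Fintype σ]

theorem hasSum_mvPowerSeries_mul_coe {f : MvPowerSeries σ R} {a : σ → R} {s : R}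
    (hf : HasSum (fun d => MvPowerSeries.coeff d f * ∏ m, a m ^ d m) s) (q : MvPolynomial σ R) :
    HasSum (fun d => MvPowerSeries.coeff d (f * (q : MvPowerSeries σ R)) * ∏ m, a m ^ d m)
      (s * q.eval a) := by
  classical
  induction q using MvPolynomial.induction_on' with
  | monomial e r =>
    have hshift (d : σ →₀ ℕ) : MvPowerSeries.coeff (d + e) (f * MvPowerSeries.monomial e r) *
        ∏ m, a m ^ (d + e) m = MvPowerSeries.coeff d f * (∏ m, a m ^ d m) *
          (r * ∏ m, a m ^ e m) := by
      simp only [MvPowerSeries.coeff_add_mul_monomial, Finsupp.add_apply, pow_add,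
        Finset.prod_mul_distrib]
      ring
    rw [MvPolynomial.eval_monomial, Finsupp.prod_pow, MvPolynomial.coe_monomial,
      ← (add_left_injective e).hasSum_iff]
    · simpa only [Function.comp_def, hshift] using hf.mul_right (r * ∏ m, a m ^ e m)
    · intro d hd
      rw [MvPowerSeries.coeff_mul_monomial, if_neg, zero_mul]
      exact fun hle => hd ⟨d - e, tsub_add_cancel_of_le hle⟩
  | add p q hp hq => simpa [mul_add, add_mul] using hp.add hq

theorem hasSum_mvPowerSeries_coe (a : σ → R) (q : MvPolynomial σ R) :
    HasSum (fun d => MvPowerSeries.coeff d (q : MvPowerSeries σ R) * ∏ m, a m ^ d m)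
      (q.eval a) := by
  classical
  have hone : HasSum (fun d => MvPowerSeries.coeff d (1 : MvPowerSeries σ R) * ∏ m, a m ^ d m)
      1 := by
    convert hasSum_single (0 : σ →₀ ℕ) fun d hd => ?_ using 1
    · simp
    · simp [MvPowerSeries.coeff_one, hd]
  simpa using hasSum_mvPowerSeries_mul_coe hone q

end HasSum

theorem eq_zero_of_forall_hasSum_pow {k : Type*} [NontriviallyNormedField k] {c : ℕ → k}
    (hc : ∀ x, ‖x‖ ≤ 1 → HasSum (fun n => c n * x ^ n) 0) : c = 0 := by
  let p : FormalMultilinearSeries k k k := .ofScalars k c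
  have hradius : 1 ≤ p.radius := by
    refine p.le_radius_of_tendsto (r := 1) (l := 0) ?_
    simpa [p, FormalMultilinearSeries.ofScalars_norm] using
      (hc 1 norm_one.le).summable.tendsto_atTop_zero.norm
  have hp : HasFPowerSeriesOnBall (fun _ => 0) p 0 1 := by
    refine ⟨hradius, one_pos, fun {y} hy => ?_⟩
    have hy_le : ‖y‖ ≤ 1 := by simpa [← ofReal_norm] using (mem_eball_zero_iff.mp hy).le
    simpa [p, FormalMultilinearSeries.ofScalars_apply_eq, mul_comm] using hc y hy_le
  exact (FormalMultilinearSeries.ofScalars_series_eq_zero k).mp hp.hasFPowerSeriesAt.eq_zero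

/-- A multi-index in `l + 1` variables as the exponent of the first variable together with the
multi-index of the others. -/
noncomputable def finsuppConsEquiv (l : ℕ) : ℕ × (Fin l →₀ ℕ) ≃ (Fin (l + 1) →₀ ℕ) where
  toFun jd := jd.2.cons jd.1
  invFun d := (d 0, d.tail)
  left_inv jd := by simp
  right_inv d := by simp

theorem eq_zero_of_forall_hasSum_prod_pow {k : Type*} [NontriviallyNormedField k]
    [CompleteSpace k] {l : ℕ} {c : (Fin l →₀ ℕ) → k}
    (hc : ∀ a : Fin l → k, (∀ m, ‖a m‖ ≤ 1) → HasSum (fun d => c d * ∏ m, a m ^ d m) 0) :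
    c = 0 := by
  induction l with
  | zero =>
    ext d
    simpa [Subsingleton.elim d default] using (hasSum_unique _).unique (hc 0 finZeroElim)
  | succ l ih =>
    have hcons (x : k) (hx : ‖x‖ ≤ 1) (a : Fin l → k) (ha : ∀ m, ‖a m‖ ≤ 1) :
        HasSum (fun jd : ℕ × (Fin l →₀ ℕ) =>
          c (jd.2.cons jd.1) * (∏ m, a m ^ jd.2 m) * x ^ jd.1) 0 := by
      simpa [finsuppConsEquiv, Function.comp_def, Fin.prod_univ_succ, mul_assoc,
        mul_comm (x ^ _)] using
        (finsuppConsEquiv l).hasSum_iff.mpr (hc (Fin.cons x a) (Fin.cases hx ha))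
    have hzero (j : ℕ) : (fun d : Fin l →₀ ℕ => c (d.cons j)) = 0 := by
      refine ih fun a ha => ?_
      have hfiber (i : ℕ) : Summable fun d : Fin l →₀ ℕ => c (d.cons i) * ∏ m, a m ^ d m := by
        simpa using (hcons 1 norm_one.le a ha).summable.prod_factor i
      have htsum := eq_zero_of_forall_hasSum_pow fun x hx =>
        (hcons x hx a ha).prod_fiberwise fun i => (hfiber i).hasSum.mul_right (x ^ i)
      simpa using (hfiber j).hasSum_iff.mpr (congrFun htsum j)
    ext d
    simpa using congrFun (hzero (d 0)) d.tail

theorem not_countable_closedBall (k : Type*) [NontriviallyNormedField k] [CompleteSpace k] :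
    ¬ (Metric.closedBall (0 : k) 1).Countable := by
  intro h
  have hball := continuum_le_cardinal_of_isOpen k (Metric.isOpen_ball (x := (0 : k)) (ε := 1))
    ⟨0, by simp⟩
  have hcountable :=
    Cardinal.le_aleph0_iff_set_countable.mpr (h.mono Metric.ball_subset_closedBall)
  exact (hball.trans hcountable).not_gt Cardinal.aleph0_lt_continuum

theorem mvPowerSeries_isRationalFunction_of_mul_eq {k : Type*} [Field k] {l : ℕ}
    {F : MvPowerSeries (Fin l) k} {p q : MvPolynomial (Fin l) k} (hq : q ≠ 0)
    (h : F * (q : MvPowerSeries (Fin l) k) = p) : F.IsRationalFunction := by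
  refine ⟨p, q, hq, eq_div_of_mul_eq ?_ (by rw [← map_mul, h])⟩
  rwa [Ne, map_eq_zero_iff _ (FaithfulSMul.algebraMap_injective _ _), MvPolynomial.coe_eq_zero_iff]

theorem exists_isCoprime_of_powerSeries_isRationalFunction {k : Type*} [Field k]
    {f : PowerSeries k} (hf : f.IsRationalFunction) :
    ∃ u w : k[X], IsCoprime u w ∧ f * (w : PowerSeries k) = u := by
  obtain ⟨p, q, hq, hpq⟩ := hf
  have hinj := FaithfulSMul.algebraMap_injective (PowerSeries k) (FractionRing (PowerSeries k))
  have hq_coe : (q : PowerSeries k) ≠ 0 := by rwa [Ne, Polynomial.coe_eq_zero_iff]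
  rw [eq_div_iff ((map_ne_zero_iff _ hinj).mpr hq_coe), ← map_mul, hinj.eq_iff] at hpq
  let r : RatFunc k := algebraMap k[X] _ p / algebraMap k[X] _ q
  have hr : r.num * q = p * r.denom := (RatFunc.num_mul_eq_mul_denom_iff hq).mpr rfl
  refine ⟨r.num, r.denom, r.isCoprime_num_denom, mul_right_cancel₀ hq_coe ?_⟩
  rw [← Polynomial.coe_mul, hr, Polynomial.coe_mul, ← hpq, mul_right_comm]

theorem exists_eval_ne_zero_and_mul_eval_eq_of_isRationalFunction {k : Type*} [Field k]
    [TopologicalSpace k] [IsTopologicalRing k] [T2Space k] {f : PowerSeries k}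
    (hf : f.IsRationalFunction) :
    ∃ u w : k[X], ∀ x s, HasSum (fun n => PowerSeries.coeff n f * x ^ n) s →
      w.eval x ≠ 0 ∧ s * w.eval x = u.eval x := by
  obtain ⟨u, w, ⟨b, c, hbc⟩, hfw⟩ := exists_isCoprime_of_powerSeries_isRationalFunction hf
  refine ⟨u, w, fun x s hs => ?_⟩
  have hsw : s * w.eval x = u.eval x :=
    (hasSum_powerSeries_mul_coe hs w).unique (hfw ▸ hasSum_powerSeries_coe x u)
  refine ⟨fun hw => ?_, hsw⟩
  have hu : u.eval x = 0 := by rw [← hsw, hw, mul_zero]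
  simpa [hu, hw] using congrArg (eval x) hbc

/-- The power series `F` converges (unconditionally) at every point of the closed unit polydisc. -/
def ConvergesOnPolydisc {k : Type*} [NormedField k] {l : ℕ} (F : MvPowerSeries (Fin l) k) : Prop :=
  ∀ a : Fin l → k, (∀ m, ‖a m‖ ≤ 1) →
    Summable fun d => MvPowerSeries.coeff d F * ∏ m, a m ^ d m

/-- The value at `a` of the power series `F`, with the junk value `0` where `F` does not
converge. -/
noncomputable def polydiscSum {k : Type*} [NormedField k] {l : ℕ} (F : MvPowerSeries (Fin l) k)
    (a : Fin l → k) : k :=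
  ∑' d, MvPowerSeries.coeff d F * ∏ m, a m ^ d m

theorem prod_update_pow {M : Type*} [CommMonoid M] {σ : Type*} [Fintype σ] [DecidableEq σ]
    (a : σ → M) (n : σ) (x : M) (d : σ → ℕ) :
    ∏ m, Function.update a n x m ^ d m = (∏ m ∈ Finset.univ.erase n, a m ^ d m) * x ^ d n := by
  rw [← Finset.prod_erase_mul _ _ (Finset.mem_univ n), Function.update_self]
  congr 1
  exact Finset.prod_congr rfl fun m hm => by rw [Function.update_of_ne (Finset.ne_of_mem_erase hm)]

theorem ConvergesOnPolydisc.hasSum_coeff_specializeExcept {k : Type*} [NormedField k]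
    [CompleteSpace k] {l : ℕ} {F : MvPowerSeries (Fin l) k} (hF : ConvergesOnPolydisc F)
    (n : Fin l) {a : Fin l → k} (ha : ∀ m, ‖a m‖ ≤ 1) {x : k} (hx : ‖x‖ ≤ 1) :
    HasSum (fun j => PowerSeries.coeff j (F.specializeExcept n a) * x ^ j)
      (polydiscSum F (Function.update a n x)) := by
  have hsigma {y : k} (hy : ‖y‖ ≤ 1) :
      HasSum (fun d : Σ j, {d : Fin l →₀ ℕ // d n = j} => MvPowerSeries.coeff d.2.1 F *
        (∏ m ∈ Finset.univ.erase n, a m ^ d.2.1 m) * y ^ d.1)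
        (polydiscSum F (Function.update a n y)) := by
    have hay (m : Fin l) : ‖Function.update a n y m‖ ≤ 1 := by
      rcases eq_or_ne m n with rfl | hm <;> simp [*]
    rw [← (Equiv.sigmaFiberEquiv fun d : Fin l →₀ ℕ => d n).symm.hasSum_iff]
    simpa [Function.comp_def, prod_update_pow, mul_assoc, polydiscSum] using (hF _ hay).hasSum
  have hfiber (j : ℕ) : Summable fun d : {d : Fin l →₀ ℕ // d n = j} =>
      MvPowerSeries.coeff d.1 F * ∏ m ∈ Finset.univ.erase n, a m ^ d.1 m := by
    simpa using (hsigma norm_one.le).summable.sigma_factor j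
  simpa [MvPowerSeries.specializeExcept] using
    (hsigma hx).sigma fun j => (hfiber j).hasSum.mul_right (x ^ j)

theorem ConvergesOnPolydisc.isSeparatelyRationalOn {k : Type*} [NormedField k] [CompleteSpace k]
    {l : ℕ} {F : MvPowerSeries (Fin l) k} (hF : ConvergesOnPolydisc F)
    (hrat : ∀ (n : Fin l) (a : Fin l → k), (∀ m, ‖a m‖ ≤ 1) →
      (F.specializeExcept n a).IsRationalFunction) :
    IsSeparatelyRationalOn (polydiscSum F) (Metric.closedBall 0 1) := by
  simp only [IsSeparatelyRationalOn, mem_closedBall_zero_iff]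
  intro n a ha
  obtain ⟨u, w, huw⟩ := exists_eval_ne_zero_and_mul_eval_eq_of_isRationalFunction (hrat n a ha)
  exact ⟨u, w, fun x hx => huw x _ (hF.hasSum_coeff_specializeExcept n ha hx)⟩

theorem ConvergesOnPolydisc.isRationalFunction_of_isRationalOn {k : Type*}
    [NontriviallyNormedField k] [CompleteSpace k] {l : ℕ} {F : MvPowerSeries (Fin l) k}
    (hF : ConvergesOnPolydisc F) (h : IsRationalOn (polydiscSum F) (Metric.closedBall 0 1)) :
    F.IsRationalFunction := by
  obtain ⟨p, q, hq, hpq⟩ := h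
  refine mvPowerSeries_isRationalFunction_of_mul_eq hq (MvPowerSeries.ext fun d => ?_) (p := p)
  rw [← sub_eq_zero]
  refine congrFun (eq_zero_of_forall_hasSum_prod_pow (c := fun d =>
    MvPowerSeries.coeff d (F * (q : MvPowerSeries (Fin l) k)) -
      MvPowerSeries.coeff d (p : MvPowerSeries (Fin l) k)) fun a ha => ?_) d
  have hsum := (hasSum_mvPowerSeries_mul_coe (hF a ha).hasSum q).sub (hasSum_mvPowerSeries_coe a p)
  have hpqa := hpq a fun m => mem_closedBall_zero_iff.mpr (ha m)
  rw [polydiscSum] at hpqa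
  rw [hpqa, sub_self] at hsum
  simpa only [sub_mul] using hsum

theorem convergesOnPolydisc_of_isRestricted {k : Type*} [NormedField k] [IsUltrametricDist k]
    [CompleteSpace k] {l : ℕ} {F : MvPowerSeries (Fin l) k}
    (hF : MvPowerSeries.IsRestricted (fun _ => 1) F) : ConvergesOnPolydisc F := by
  intro a ha
  refine NonarchimedeanAddGroup.summable_of_tendsto_cofinite_zero
    (squeeze_zero_norm (fun d => ?_) (by simpa [MvPowerSeries.IsRestricted] using hF))
  rw [norm_mul, norm_prod]
  refine mul_le_of_le_one_right (norm_nonneg _)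
    (Finset.prod_le_one (fun _ _ => norm_nonneg _) fun m _ => ?_)
  rw [norm_pow]
  exact pow_le_one₀ (norm_nonneg _) (ha m)

theorem proposition3p8_general {k : Type*} [NontriviallyNormedField k] [CompleteSpace k] {l : ℕ}
    (F : MvPowerSeries (Fin l) k) (hF : ConvergesOnPolydisc F)
    (hrat : ∀ (n : Fin l) (a : Fin l → k), (∀ m, ‖a m‖ ≤ 1) →
      (F.specializeExcept n a).IsRationalFunction) :
    F.IsRationalFunction :=
  hF.isRationalFunction_of_isRationalOn
    ((hF.isSeparatelyRationalOn hrat).isRationalOn (not_countable_closedBall k))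

theorem proposition3p8 {k : Type*} [NontriviallyNormedField k] [IsUltrametricDist k]
    [CompleteSpace k] {l : ℕ} (F : MvPowerSeries (Fin l) k)
    (hF : MvPowerSeries.IsRestricted (fun _ => 1) F)
    (hrat : ∀ (n : Fin l) (a : Fin l → k), (∀ m, ‖a m‖ ≤ 1) →
      (F.specializeExcept n a).IsRationalFunction) :
    F.IsRationalFunction :=
  proposition3p8_general F (convergesOnPolydisc_of_isRestricted hF) hrat
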